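/- Let $n\ge 1$, $k\ge 0$, let $A,C\in\mathbb R^{n\times n}$, $B,D\in\mathbb R^{n\times k}$, $L\in\mathbb R^{k\times n}$, $Q\in\mathbb R^{n\times n}$ and $R\in\mathbb R^{k\times k}$ be constant matrices, and assume that the block matrix $\begin{pmatrix}Q&L'\\L&R\end{pmatrix}$ is (symmetric) positive definite. Let $\mathcal C_0$ be the set of real symmetric positive definite $n\times n$ matrices, $\le$ the Loewner order, and for a symmetric matrix $X$ and $Y\in\mathcal C_0$ put $$M(X/Y)=\inf\{t\in\mathbb R: X\le tY\},\qquad m(X/Y)=\sup\{t\in\mathbb R: tY\le X\}.$$ The Thompson metric on $\mathcal C_0$ is $d_T(X,Y)=\log\max\{M(X/Y),M(Y/X)\}$. Let $M_t(P)$ denote the value at time $t\ge0$ of the maximal $\mathcal C_0$-valued $C^1$ solution, started at $P\in\mathcal C_0$ at time $0$, of the generalized Riccati differential equation $$\dot P=A'P+PA+C'PC+Q-(PB+C'PD+L')(R+D'PD)^{-1}(B'P+D'PC+L).$$ For $U\subset\mathcal C_0$ and $P\in U$, let $t_U(P)\in[-\infty,\infty]$ be the supremum of all real $b>0$ smaller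 than the lifetime of that solution such that $M_t(P)\in U$ for all $t\in[0,b)$ (with $t_U(P)=-\infty$ if there is no such $b$). Then the following hold. 1. Let $U\subset\mathcal C_0$ be open in the space of symmetric matrices with $\lambda U\subset U$ for all $\lambda\in(0,1]$, let $P_0\in\mathcal C_0$ be such that $P\le P_0$ for all $P\in U$, and let $\alpha=m\big((Q-L'R^{-1}L)/P_0\big)$. Then $\alpha>0$, and for all $P_1,P_2\in U$, $$d_T(M_t(P_1),M_t(P_2))\le e^{-\alpha t}\,d_T(P_1,P_2),\qquad 0\le t<\min\{t_U(P_1),t_U(P_2)\}.$$ 2. The flow is a strict contraction on $\mathcal C_0$: for all $P_1\ne P_2$ in $\mathcal C_0$ and $0<t<\min\{t_{\mathcal C_0}(P_1),t_{\mathcal C_0}(P_2)\}$, one has $d_T(M_t(P_1),M_t(P_2))<d_T(P_1,P_2)$. 3. The contraction is uniform on every set $S\subset\mathcal C_0$ that is bounded from above in the Loewner order, in the following two senses. (a) There is $\alpha>0$ such that $d_T(M_t(P_1),M_t(P_2))\le e^{-\alpha t}d_T(P_1,P_2)$ for all $P_1,P_2\in S$ and $0\le t<\min\{t_S(P_1),t_S(P_2)\}$.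 (b) For every $T>0$ there is $\alpha>0$ such that $d_T(M_t(P_1),M_t(P_2))\le e^{-\alpha t}d_T(P_1,P_2)$ for all $P_1,P_2\in S$ and all $0\le t\le T$ with $t<\min\{t_{\mathcal C_0}(P_1),t_{\mathcal C_0}(P_2)\}$. -/

import Mathlib

open scoped MatrixOrder

noncomputable section

namespace GRDE

section Flow

variable {E : Type*} [AddCommGroup E] [Module ℝ E] [TopologicalSpace E]
  [ContinuousAdd E] [ContinuousSMul ℝ E]

/-- `X` is a solution on `[0,b)`, `0 < b ≤ ∞`, of `X' = φ(X)`, `X(0) = x₀`, with values in the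
domain `𝒟`: a continuously differentiable function `[0,b) → 𝒟` (one-sided derivative at `0`). -/
def IsSolution (φ : E → E) (𝒟 : Set E) (x₀ : E) (b : EReal) (X : ℝ → E) : Prop :=
  0 < b ∧ X 0 = x₀ ∧
  (∀ t : ℝ, 0 ≤ t → (t : EReal) < b → X t ∈ 𝒟) ∧
  (∀ t : ℝ, 0 ≤ t → (t : EReal) < b → HasDerivWithinAt X (φ (X t)) (Set.Ici 0) t) ∧
  ContinuousOn (fun t => φ (X t)) {t : ℝ | 0 ≤ t ∧ (t : EReal) < b}

/-- The supremum of the existence times of solutions: the maximal solution started at `x₀`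
lives on `[0, lifetime φ 𝒟 x₀)`. It is `⊥` if there is no solution at all. -/
def lifetime (φ : E → E) (𝒟 : Set E) (x₀ : E) : EReal :=
  sSup {b : EReal | ∃ X : ℝ → E, IsSolution φ 𝒟 x₀ b X}

open Classical in
/-- The flow `M_t(x₀)`: the value at time `t` of a solution started at `x₀` that lives beyond time
`t` (junk value `0` for `t` beyond the lifetime). -/
def flow (φ : E → E) (𝒟 : Set E) (t : ℝ) (x₀ : E) : E :=
  if h : ∃ X : ℝ → E, ∃ b : EReal, (t : EReal) < b ∧ IsSolution φ 𝒟 x₀ b X then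
    Classical.choose h t
  else 0

/-- The first time `t_U(x₀)` at which the trajectory started at `x₀` leaves `U`:
`sup {b ∈ (0, lifetime) | M_t(x₀) ∈ U for all t ∈ [0,b)}`. -/
def exitTime (φ : E → E) (𝒟 : Set E) (U : Set E) (x₀ : E) : EReal :=
  sSup {e : EReal | ∃ b : ℝ, e = (b : EReal) ∧ 0 < b ∧ (b : EReal) < lifetime φ 𝒟 x₀ ∧
    ∀ t : ℝ, 0 ≤ t → t < b → flow φ 𝒟 t x₀ ∈ U}

end Flow

section Thompson

variable {n : ℕ}

/-- `M(X/Y) = inf {t | X ≤ tY}` in the Loewner order (for `Y` positive definite). -/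
def upperRatio (X Y : Matrix (Fin n) (Fin n) ℝ) : ℝ := sInf {t : ℝ | X ≤ t • Y}

/-- `m(X/Y) = sup {t | tY ≤ X}` in the Loewner order (for `Y` positive definite). -/
def lowerRatio (X Y : Matrix (Fin n) (Fin n) ℝ) : ℝ := sSup {t : ℝ | t • Y ≤ X}

/-- The Thompson part metric on positive definite matrices. -/
def thompson (X Y : Matrix (Fin n) (Fin n) ℝ) : ℝ :=
  Real.log (max (upperRatio X Y) (upperRatio Y X))

/-- The set of real positive definite (symmetric) matrices. -/
def posDefCone (n : ℕ) : Set (Matrix (Fin n) (Fin n) ℝ) := {P | P.PosDef}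

/-- `U` is a set of symmetric matrices that is open in the space of symmetric matrices. -/
def IsOpenInSym (U : Set (Matrix (Fin n) (Fin n) ℝ)) : Prop :=
  U ⊆ {P | P.IsSymm} ∧
    IsOpen ((fun P : {P : Matrix (Fin n) (Fin n) ℝ // P.IsSymm} => P.1) ⁻¹' U)

end Thompson

/-- The constant coefficients of a generalized Riccati differential equation. -/
structure Coeffs (n k : ℕ) where
  A : Matrix (Fin n) (Fin n) ℝ
  B : Matrix (Fin n) (Fin k) ℝ
  C : Matrix (Fin n) (Fin n) ℝ
  D : Matrix (Fin n) (Fin k) ℝ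
  L : Matrix (Fin k) (Fin n) ℝ
  Q : Matrix (Fin n) (Fin n) ℝ
  R : Matrix (Fin k) (Fin k) ℝ

namespace Coeffs

variable {n k : ℕ} (c : Coeffs n k)

/-- The right-hand side of the generalized Riccati differential equation. -/
def phi (P : Matrix (Fin n) (Fin n) ℝ) : Matrix (Fin n) (Fin n) ℝ :=
  c.A.transpose * P + P * c.A + c.C.transpose * P * c.C + c.Q
    - (P * c.B + c.C.transpose * P * c.D + c.L.transpose)
      * (c.R + c.D.transpose * P * c.D)⁻¹
      * (c.B.transpose * P + c.D.transpose * P * c.C + c.L)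

/-- The weight matrix `[[Q, L'], [L, R]]`. -/
def weight : Matrix (Fin n ⊕ Fin k) (Fin n ⊕ Fin k) ℝ :=
  Matrix.fromBlocks c.Q c.L.transpose c.L c.R

/-- The flow `M_t` of the equation `P' = phi P` on the set of positive definite matrices. -/
def M (t : ℝ) (P : Matrix (Fin n) (Fin n) ℝ) : Matrix (Fin n) (Fin n) ℝ :=
  flow c.phi (posDefCone n) t P

/-- The exit time `t_U(P)` of this flow. -/
def exit (U : Set (Matrix (Fin n) (Fin n) ℝ)) (P : Matrix (Fin n) (Fin n) ℝ) : EReal :=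
  exitTime c.phi (posDefCone n) U P

end Coeffs

end GRDE

end

/-!
For a fixed feedback gain `K` the map `P ↦ closedLoop K P + cost K` is affine and its linear part
generates an order-preserving flow; completing the square shows that `phi` is the minimum of these
maps over `K`. Hence a function growing no faster than `closedLoop K + cost K`, with `K` the optimal
gain along a solution, stays below that solution.

Let `X₁ ≤ exp d • X₂` at time `0` and `α • X₁ ≤ minCost` along the trajectory of `X₁`. With
`x s = exp (-α s) d`, the function `exp (-x) • X₁` grows slowly enough to stay below `X₂`: the
factor `exp (-x)` has derivative `α x exp (-x)`, where `x exp (-x) ≤ 1 - exp (-x)`, and scaling by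
`exp (-x)` leaves the cost `(1 - exp (-x)) • cost K ≥ (1 - exp (-x)) • α • X₁` unused. So the
Thompson distance decays at rate `α`. Trajectories issuing from a set bounded above by `B` stay
below the supersolution `exp (κ t) • B` for a suitable `κ`, so on bounded time intervals one rate
serves them all.
-/

noncomputable section

namespace GRDE

open Matrix Set Filter Topology

section LoewnerOrder

variable {ι : Type*} {H X Y : Matrix ι ι ℝ}

lemma isHermitian_smul (hH : H.IsHermitian) (r : ℝ) : (r • H).IsHermitian :=
  hH.smul (.all r)

lemma posDef_of_le (hX : X.PosDef) (h : X ≤ Y) : Y.PosDef := by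
  simpa only [add_sub_cancel] using hX.add_posSemidef (le_iff.1 h)

lemma exists_posDef_forall_le_of_bddAbove {S : Set (Matrix ι ι ℝ)} (hS : BddAbove S) :
    ∃ B : Matrix ι ι ℝ, B.PosDef ∧ ∀ X ∈ S, X.PosDef → X ≤ B := by
  classical
  obtain ⟨B, hB⟩ := hS
  by_cases hBpos : B.PosDef
  · exact ⟨B, hBpos, fun X hX _ => hB hX⟩
  · exact ⟨1, PosDef.one, fun X hX hXpos => absurd (posDef_of_le hXpos (hB hX)) hBpos⟩

open scoped Matrix.Norms.L2Operator in
lemma le_norm_smul_one [Fintype ι] [DecidableEq ι] (hH : H.IsHermitian) :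
    H ≤ ‖H‖ • (1 : Matrix ι ι ℝ) := by
  nontriviality Matrix ι ι ℝ
  rw [← Algebra.algebraMap_eq_smul_one]
  exact le_algebraMap_of_spectrum_le (ha := hH)
    fun r hr => (Real.le_norm_self r).trans (spectrum.norm_le_norm_of_mem hr)

variable [Finite ι]

lemma isClosed_setOf_nonneg : IsClosed {H : Matrix ι ι ℝ | 0 ≤ H} := by
  cases nonempty_fintype ι
  simp only [nonneg_iff_posSemidef, posSemidef_iff_dotProduct_mulVec, IsHermitian, ofPred_and,
    ofPred_forall]
  exact (isClosed_eq (by fun_prop) continuous_id).inter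
    (isClosed_iInter fun v => isClosed_le continuous_const (by fun_prop))

instance instOrderClosedTopologyMatrix : OrderClosedTopology (Matrix ι ι ℝ) :=
  ⟨isClosed_le_of_isClosed_nonneg isClosed_setOf_nonneg⟩

lemma posDef_pos [Nonempty ι] (hY : Y.PosDef) : 0 < Y := by
  classical
  cases nonempty_fintype ι
  exact hY.posSemidef.nonneg.lt_of_ne' hY.isUnit.ne_zero

lemma exists_forall_le_smul_one [DecidableEq ι] {α : Type*} [TopologicalSpace α] {s : Set α}
    (hs : IsCompact s) {H : α → Matrix ι ι ℝ} (hH : ContinuousOn H s)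
    (hherm : ∀ x ∈ s, (H x).IsHermitian) :
    ∃ β : ℝ, ∀ x ∈ s, H x ≤ β • (1 : Matrix ι ι ℝ) := by
  cases nonempty_fintype ι
  open scoped Matrix.Norms.L2Operator in
  obtain ⟨β, hβ⟩ := hs.exists_bound_of_continuousOn hH
  exact ⟨β, fun x hx => (le_norm_smul_one (hherm x hx)).trans
    (smul_le_smul_of_nonneg_right (hβ x hx) zero_le_one)⟩

lemma exists_pos_smul_one_le [DecidableEq ι] (hY : Y.PosDef) :
    ∃ r : ℝ, 0 < r ∧ r • (1 : Matrix ι ι ℝ) ≤ Y := by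
  cases nonempty_fintype ι
  cases subsingleton_or_nontrivial (Matrix ι ι ℝ)
  · exact ⟨1, one_pos, (Subsingleton.elim _ _).le⟩
  simp only [← Algebra.algebraMap_eq_smul_one]
  exact (CFC.exists_pos_algebraMap_le_iff hY.1).2 fun r hr => hY.isStrictlyPositive.spectrum_pos hr

lemma exists_pos_le_smul (hX : X.IsHermitian) (hY : Y.PosDef) : ∃ r : ℝ, 0 < r ∧ X ≤ r • Y := by
  classical
  cases nonempty_fintype ι
  open scoped Matrix.Norms.L2Operator in
  obtain ⟨r, hr, hrY⟩ := exists_pos_smul_one_le hY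
  refine ⟨(‖X‖ + 1) * r⁻¹, by positivity, ?_⟩
  calc X ≤ ‖X‖ • 1 := le_norm_smul_one hX
    _ ≤ (‖X‖ + 1) • 1 := smul_le_smul_of_nonneg_right (by linarith) zero_le_one
    _ ≤ (‖X‖ + 1) • r⁻¹ • Y :=
        smul_le_smul_of_nonneg_left ((le_inv_smul_iff_of_pos hr).2 hrY) (by positivity)
    _ = ((‖X‖ + 1) * r⁻¹) • Y := smul_smul _ _ _

lemma exists_pos_smul_le (hX : X.IsHermitian) (hY : Y.PosDef) : ∃ r : ℝ, 0 < r ∧ r • X ≤ Y := by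
  cases nonempty_fintype ι
  obtain ⟨r, hr, hXY⟩ := exists_pos_le_smul hX hY
  exact ⟨r⁻¹, inv_pos.2 hr, (inv_smul_le_iff_of_pos hr).2 hXY⟩

lemma exists_pos_forall_smul_le_of_bddAbove {S : Set (Matrix ι ι ℝ)} (hS : BddAbove S)
    (hY : Y.PosDef) : ∃ r : ℝ, 0 < r ∧ ∀ X ∈ S, X.PosDef → r • X ≤ Y := by
  cases nonempty_fintype ι
  obtain ⟨B, hBpos, hB⟩ := exists_posDef_forall_le_of_bddAbove hS
  obtain ⟨r, hr, hrB⟩ := exists_pos_smul_le hBpos.1 hY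
  exact ⟨r, hr, fun X hX hXpos => (smul_le_smul_of_nonneg_left (hB X hX hXpos) hr.le).trans hrB⟩

lemma eventually_posDef_of_tendsto {α : Type*} {l : Filter α} {H : α → Matrix ι ι ℝ}
    (hH : ∀ᶠ x in l, (H x).IsHermitian) (hY : Y.PosDef) (hlim : Tendsto H l (𝓝 Y)) :
    ∀ᶠ x in l, (H x).PosDef := by
  classical
  cases nonempty_fintype ι
  open scoped Matrix.Norms.L2Operator in
  obtain ⟨r, hr, hrY⟩ := exists_pos_smul_one_le hY
  filter_upwards [hH, hlim.eventually (Metric.ball_mem_nhds Y (half_pos hr))] with x hx hxr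
  rw [dist_eq_norm'] at hxr
  have hsub : Y - H x ≤ (r / 2) • (1 : Matrix ι ι ℝ) :=
    (le_norm_smul_one (hY.1.sub hx)).trans (smul_le_smul_of_nonneg_right hxr.le zero_le_one)
  refine posDef_of_le (PosDef.one.smul (half_pos hr)) ?_
  calc (r / 2) • (1 : Matrix ι ι ℝ) = r • 1 - (r / 2) • 1 := by rw [← sub_smul, sub_half]
    _ ≤ Y - (Y - H x) := sub_le_sub hrY hsub
    _ = H x := sub_sub_cancel _ _

end LoewnerOrder

section Lyapunov

variable {ι : Type*} [Fintype ι]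

/-- The generalized Lyapunov operator `X ↦ FᵀX + XF + GᵀXG`. It generates an order-preserving
flow. -/
def lyapunov (F G : Matrix ι ι ℝ) : Matrix ι ι ℝ →ₗ[ℝ] Matrix ι ι ℝ where
  toFun X := Fᵀ * X + X * F + Gᵀ * X * G
  map_add' X Y := by simp only [mul_add, add_mul]; abel
  map_smul' r X := by simp [smul_add]

lemma lyapunov_apply (F G X : Matrix ι ι ℝ) :
    lyapunov F G X = Fᵀ * X + X * F + Gᵀ * X * G := rfl

lemma isHermitian_lyapunov (F G : Matrix ι ι ℝ) {X : Matrix ι ι ℝ} (hX : X.IsHermitian) :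
    (lyapunov F G X).IsHermitian := by
  simp only [IsHermitian, conjTranspose_eq_transpose_of_trivial] at hX ⊢
  simp only [lyapunov_apply, transpose_add, transpose_mul, transpose_transpose, hX,
    Matrix.mul_assoc]
  abel

lemma nonneg_transpose_mul_mul {ι' : Type*} [Finite ι'] {X : Matrix ι ι ℝ} (hX : 0 ≤ X)
    (K : Matrix ι ι' ℝ) : 0 ≤ Kᵀ * X * K := by
  cases nonempty_fintype ι'
  simpa [nonneg_iff_posSemidef, conjTranspose_eq_transpose_of_trivial] using
    (nonneg_iff_posSemidef.1 hX).conjTranspose_mul_mul_same K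

lemma add_smul_lyapunov_eq [DecidableEq ι] (F G X : Matrix ι ι ℝ) (h : ℝ) :
    X + h • lyapunov F G X + h ^ 2 • (Fᵀ * X * F) =
      (1 + h • F)ᵀ * X * (1 + h • F) + h • (Gᵀ * X * G) := by
  simp only [lyapunov_apply, transpose_add, transpose_one, transpose_smul, Matrix.add_mul,
    Matrix.mul_add, Matrix.one_mul, Matrix.mul_one, Matrix.smul_mul, Matrix.mul_smul, smul_add,
    smul_smul, pow_two]
  abel

variable {F G Δ Δ' : ℝ → Matrix ι ι ℝ} {a b : ℝ}

lemma eventually_nonneg_of_hasDerivWithinAt {s : ℝ} {F G : Matrix ι ι ℝ} {Δ : ℝ → Matrix ι ι ℝ}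
    {Δ' : Matrix ι ι ℝ} (hherm : ∀ᶠ r in 𝓝[>] s, (Δ r).IsHermitian) (hs : 0 ≤ Δ s)
    (hderiv : HasDerivWithinAt Δ Δ' (Ici s) s) (hlt : (Δ' - lyapunov F G (Δ s)).PosDef) :
    ∀ᶠ r in 𝓝[>] s, 0 ≤ Δ r := by
  classical
  have hΔs : (Δ s).IsHermitian := (nonneg_iff_posSemidef.1 hs).1
  let E : ℝ → Matrix ι ι ℝ := fun r =>
    slope Δ s r - lyapunov F G (Δ s) - (r - s) • (Fᵀ * Δ s * F)
  have hE_herm : ∀ᶠ r in 𝓝[>] s, (E r).IsHermitian := by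
    filter_upwards [hherm] with r hr
    refine ((isHermitian_smul (hr.sub hΔs) _).sub (isHermitian_lyapunov F G hΔs)).sub
      (isHermitian_smul ?_ _)
    simpa only [conjTranspose_eq_transpose_of_trivial] using
      isHermitian_conjTranspose_mul_mul F hΔs
  have hE_lim : Tendsto E (𝓝[>] s) (𝓝 (Δ' - lyapunov F G (Δ s))) := by
    have hslope : Tendsto (slope Δ s) (𝓝[>] s) (𝓝 Δ') := by
      open scoped Matrix.Norms.L2Operator in
      simpa using hasDerivWithinAt_iff_tendsto_slope.1 hderiv
    have hrem : Tendsto (fun r => (r - s) • (Fᵀ * Δ s * F)) (𝓝[>] s) (𝓝 0) := by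
      refine tendsto_nhdsWithin_of_tendsto_nhds (Continuous.tendsto' (by fun_prop) _ _ ?_)
      rw [sub_self, zero_smul]
    simpa only [sub_zero] using (hslope.sub_const _).sub hrem
  filter_upwards [eventually_posDef_of_tendsto hE_herm hlt hE_lim, self_mem_nhdsWithin]
    with r hEr hr
  rw [mem_Ioi, ← sub_pos] at hr
  have hexpand : Δ r = Δ s + (r - s) • lyapunov F G (Δ s) + (r - s) ^ 2 • (Fᵀ * Δ s * F)
      + (r - s) • E r := by
    simp only [E, slope_def_module, smul_sub, smul_smul, mul_inv_cancel₀ hr.ne', one_smul, pow_two]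
    abel
  -- To first order, `Δ + h • lyapunov F G Δ` is a congruence transform of `Δ`, hence nonnegative.
  rw [hexpand, add_smul_lyapunov_eq]
  exact add_nonneg (add_nonneg (nonneg_transpose_mul_mul hs _)
    (smul_nonneg hr.le (nonneg_transpose_mul_mul hs _))) (smul_nonneg hr.le hEr.posSemidef.nonneg)

lemma nonneg_of_posDef_sub_lyapunov (hherm : ∀ s ∈ Icc a b, (Δ s).IsHermitian)
    (hcont : ContinuousOn Δ (Icc a b))
    (hderiv : ∀ s ∈ Ico a b, HasDerivWithinAt Δ (Δ' s) (Ici s) s)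
    (hlt : ∀ s ∈ Ico a b, (Δ' s - lyapunov (F s) (G s) (Δ s)).PosDef) (ha : 0 ≤ Δ a) :
    ∀ s ∈ Icc a b, 0 ≤ Δ s := by
  refine IsClosed.Icc_subset_of_forall_mem_nhdsWithin (s := {s | 0 ≤ Δ s}) ?_ ha ?_
  · rw [inter_comm]
    exact hcont.preimage_isClosed_of_isClosed isClosed_Icc isClosed_setOf_nonneg
  · rintro s ⟨hs, hsab⟩
    exact eventually_nonneg_of_hasDerivWithinAt
      (mem_of_superset (Icc_mem_nhdsGT_of_mem hsab) hherm) hs (hderiv s hsab)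
      (hlt s hsab)

lemma posDef_add_smul_one_sub_lyapunov [DecidableEq ι] {F G X X' : Matrix ι ι ℝ} {β r : ℝ}
    (hβ : lyapunov F G 1 ≤ β • 1) (hle : lyapunov F G X ≤ X') (hr : 0 < r) :
    (X' + (r * (β + 1)) • 1 - lyapunov F G (X + r • 1)).PosDef := by
  refine posDef_of_le (PosDef.one.smul hr) ?_
  calc r • (1 : Matrix ι ι ℝ) = r • ((β + 1) • 1 - β • 1) := by
        rw [← sub_smul, add_sub_cancel_left, one_smul]
    _ ≤ r • ((β + 1) • 1 - lyapunov F G 1) :=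
        smul_le_smul_of_nonneg_left (sub_le_sub_left hβ _) hr.le
    _ ≤ (X' - lyapunov F G X) + r • ((β + 1) • 1 - lyapunov F G 1) :=
        le_add_of_nonneg_left (sub_nonneg.2 hle)
    _ = X' + (r * (β + 1)) • 1 - lyapunov F G (X + r • 1) := by
        simp only [map_add, map_smul, smul_sub, smul_smul]
        abel

lemma exists_forall_lyapunov_one_le [DecidableEq ι] {s : Set ℝ} (hs : IsCompact s)
    (hF : ContinuousOn F s) (hG : ContinuousOn G s) :
    ∃ β : ℝ, ∀ t ∈ s, lyapunov (F t) (G t) 1 ≤ β • (1 : Matrix ι ι ℝ) := by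
  refine exists_forall_le_smul_one hs ?_ fun t _ => isHermitian_lyapunov _ _ isHermitian_one
  have htranspose : Continuous fun X : Matrix ι ι ℝ => Xᵀ := by fun_prop
  have hFt := htranspose.comp_continuousOn' hF
  have hGt := htranspose.comp_continuousOn' hG
  simp only [lyapunov_apply]
  fun_prop

lemma nonneg_of_lyapunov_le (hF : ContinuousOn F (Icc a b)) (hG : ContinuousOn G (Icc a b))
    (hherm : ∀ s ∈ Icc a b, (Δ s).IsHermitian) (hcont : ContinuousOn Δ (Icc a b))
    (hderiv : ∀ s ∈ Ico a b, HasDerivWithinAt Δ (Δ' s) (Ici s) s)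
    (hle : ∀ s ∈ Ico a b, lyapunov (F s) (G s) (Δ s) ≤ Δ' s) (ha : 0 ≤ Δ a) :
    ∀ s ∈ Icc a b, 0 ≤ Δ s := by
  classical
  obtain ⟨β, hβ⟩ := exists_forall_lyapunov_one_le isCompact_Icc hF hG
  let w : ℝ → ℝ := fun s => Real.exp (s * (β + 1))
  have hw : ∀ s, HasDerivAt w (w s * (β + 1)) s := fun s => (hasDerivAt_mul_const (β + 1)).exp
  -- The perturbation makes the differential inequality strict.
  have hpert : ∀ ε > 0, ∀ s ∈ Icc a b, 0 ≤ Δ s + (ε * w s) • (1 : Matrix ι ι ℝ) := by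
    intro ε hε
    refine nonneg_of_posDef_sub_lyapunov (F := F) (G := G)
      (Δ' := fun s => Δ' s + (ε * w s * (β + 1)) • (1 : Matrix ι ι ℝ))
      (fun s hs => (hherm s hs).add (isHermitian_smul isHermitian_one _))
      (hcont.add (by fun_prop)) (fun s hs => ?_)
      (fun s hs => posDef_add_smul_one_sub_lyapunov (hβ s (Ico_subset_Icc_self hs)) (hle s hs)
        (mul_pos hε (Real.exp_pos _)))
      (add_nonneg ha (smul_nonneg (by positivity) zero_le_one))
    rw [mul_assoc]
    open scoped Matrix.Norms.L2Operator in
    exact (hderiv s hs).add (((hw s).const_mul ε).hasDerivWithinAt.smul_const 1)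
  intro s hs
  have hlim : Tendsto (fun ε : ℝ => Δ s + (ε * w s) • (1 : Matrix ι ι ℝ)) (𝓝[>] 0) (𝓝 (Δ s)) := by
    refine tendsto_nhdsWithin_of_tendsto_nhds (Continuous.tendsto' (by fun_prop) _ _ ?_)
    rw [zero_mul, zero_smul, add_zero]
  exact ge_of_tendsto hlim (by filter_upwards [self_mem_nhdsWithin] with ε hε using hpert ε hε s hs)

lemma le_of_lyapunov_add_le {H Y Y' Z Z' : ℝ → Matrix ι ι ℝ}
    (hF : ContinuousOn F (Icc a b)) (hG : ContinuousOn G (Icc a b))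
    (hYherm : ∀ s ∈ Icc a b, (Y s).IsHermitian) (hZherm : ∀ s ∈ Icc a b, (Z s).IsHermitian)
    (hY : ∀ s ∈ Icc a b, HasDerivWithinAt Y (Y' s) (Icc a b) s)
    (hZ : ∀ s ∈ Icc a b, HasDerivWithinAt Z (Z' s) (Icc a b) s)
    (hY' : ∀ s ∈ Icc a b, Y' s ≤ lyapunov (F s) (G s) (Y s) + H s)
    (hZ' : ∀ s ∈ Icc a b, lyapunov (F s) (G s) (Z s) + H s ≤ Z' s) (ha : Y a ≤ Z a) :
    ∀ s ∈ Icc a b, Y s ≤ Z s := by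
  classical
  open scoped Matrix.Norms.L2Operator in
  have hsub : ∀ s ∈ Icc a b, HasDerivWithinAt (fun r => Z r - Y r) (Z' s - Y' s) (Icc a b) s :=
    fun s hs => (hZ s hs).sub (hY s hs)
  intro s hs
  refine sub_nonneg.1 (nonneg_of_lyapunov_le hF hG (fun r hr => (hZherm r hr).sub (hYherm r hr))
    (fun r hr => (hsub r hr).continuousWithinAt)
    (fun r hr => (hsub r (Ico_subset_Icc_self hr)).mono_of_mem_nhdsWithin
      (Icc_mem_nhdsGE_of_mem hr))
    (fun r hr => ?_) (sub_nonneg.2 ha) s hs)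
  rw [map_sub, ← add_sub_add_right_eq_sub _ _ (H r)]
  exact sub_le_sub (hZ' r (Ico_subset_Icc_self hr)) (hY' r (Ico_subset_Icc_self hr))

end Lyapunov
section ThompsonMetric

variable {n : ℕ} {X Y : Matrix (Fin n) (Fin n) ℝ}

lemma thompson_comm (X Y : Matrix (Fin n) (Fin n) ℝ) : thompson X Y = thompson Y X := by
  rw [thompson, thompson, max_comm]

variable [NeZero n]

lemma bddAbove_smul_le (hX : X.PosDef) (hY : Y.PosDef) : BddAbove {t : ℝ | t • Y ≤ X} := by
  obtain ⟨r, -, hr⟩ := exists_pos_le_smul hX.1 hY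
  exact ⟨r, fun t ht => (smul_le_smul_iff_of_pos_right (posDef_pos hY)).1 (ht.trans hr)⟩

lemma lowerRatio_smul_le (hX : X.PosDef) (hY : Y.PosDef) : lowerRatio X Y • Y ≤ X := by
  obtain ⟨r, -, hr⟩ := exists_pos_smul_le hY.1 hX
  have hclosed : IsClosed {t : ℝ | t • Y ≤ X} := isClosed_le (by fun_prop) continuous_const
  exact hclosed.csSup_mem ⟨r, hr⟩ (bddAbove_smul_le hX hY)

lemma lowerRatio_pos (hX : X.PosDef) (hY : Y.PosDef) : 0 < lowerRatio X Y := by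
  obtain ⟨r, hr_pos, hr⟩ := exists_pos_smul_le hY.1 hX
  exact hr_pos.trans_le (le_csSup (bddAbove_smul_le hX hY) hr)

lemma pos_of_le_smul (hX : X.PosDef) (hY : Y.PosDef) {t : ℝ} (h : X ≤ t • Y) : 0 < t :=
  (smul_pos_iff_of_pos_right (posDef_pos hY)).1 ((posDef_pos hX).trans_le h)

lemma bddBelow_le_smul (hX : X.PosDef) (hY : Y.PosDef) : BddBelow {t : ℝ | X ≤ t • Y} :=
  ⟨0, fun _ ht => (pos_of_le_smul hX hY ht).le⟩

lemma upperRatio_le (hX : X.PosDef) (hY : Y.PosDef) {t : ℝ} (h : X ≤ t • Y) :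
    upperRatio X Y ≤ t :=
  csInf_le (bddBelow_le_smul hX hY) h

lemma le_upperRatio_smul (hX : X.PosDef) (hY : Y.PosDef) : X ≤ upperRatio X Y • Y := by
  obtain ⟨r, -, hr⟩ := exists_pos_le_smul hX.1 hY
  have hclosed : IsClosed {t : ℝ | X ≤ t • Y} := isClosed_le continuous_const (by fun_prop)
  exact hclosed.csInf_mem ⟨r, hr⟩ (bddBelow_le_smul hX hY)

lemma upperRatio_pos (hX : X.PosDef) (hY : Y.PosDef) : 0 < upperRatio X Y :=
  pos_of_le_smul hX hY (le_upperRatio_smul hX hY)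

lemma thompson_le (hX : X.PosDef) (hY : Y.PosDef) {d : ℝ} (hXY : X ≤ Real.exp d • Y)
    (hYX : Y ≤ Real.exp d • X) : thompson X Y ≤ d := by
  rw [thompson, Real.log_le_iff_le_exp (lt_max_of_lt_left (upperRatio_pos hX hY))]
  exact max_le (upperRatio_le hX hY hXY) (upperRatio_le hY hX hYX)

lemma le_exp_thompson_smul (hX : X.PosDef) (hY : Y.PosDef) : X ≤ Real.exp (thompson X Y) • Y := by
  rw [thompson, Real.exp_log (lt_max_of_lt_left (upperRatio_pos hX hY))]
  exact (le_upperRatio_smul hX hY).trans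
    (smul_le_smul_of_nonneg_right (le_max_left _ _) (posDef_pos hY).le)

lemma le_exp_thompson_smul' (hX : X.PosDef) (hY : Y.PosDef) : Y ≤ Real.exp (thompson X Y) • X :=
  thompson_comm Y X ▸ le_exp_thompson_smul hY hX

lemma thompson_nonneg (hX : X.PosDef) (hY : Y.PosDef) : 0 ≤ thompson X Y := by
  have h : (1 : ℝ) • X ≤ Real.exp (thompson X Y + thompson X Y) • X := by
    rw [one_smul, Real.exp_add, mul_smul]
    exact (le_exp_thompson_smul hX hY).trans
      (smul_le_smul_of_nonneg_left (le_exp_thompson_smul' hX hY) (Real.exp_pos _).le)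
  have := Real.one_le_exp_iff.1 ((smul_le_smul_iff_of_pos_right (posDef_pos hX)).1 h)
  linarith

lemma thompson_pos (hX : X.PosDef) (hY : Y.PosDef) (hne : X ≠ Y) : 0 < thompson X Y := by
  refine (thompson_nonneg hX hY).lt_of_ne fun h => hne ?_
  have hXY := le_exp_thompson_smul hX hY
  have hYX := le_exp_thompson_smul' hX hY
  rw [← h, Real.exp_zero, one_smul] at hXY hYX
  exact le_antisymm hXY hYX

end ThompsonMetric

section Flow

variable {E : Type*} [AddCommGroup E] [Module ℝ E] [TopologicalSpace E]
  [ContinuousSMul ℝ E] {φ : E → E} {𝒟 U : Set E} {x : E} {b : EReal} {s t : ℝ}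
  {X : ℝ → E}

/-- Solutions of `X' = φ(X)` in `𝒟` with the same initial value agree on their common interval of
existence. -/
def HasUniqueSolutions (φ : E → E) (𝒟 : Set E) : Prop :=
  ∀ ⦃x : E⦄ ⦃b b' : EReal⦄ ⦃X Y : ℝ → E⦄, IsSolution φ 𝒟 x b X → IsSolution φ 𝒟 x b' Y →
    ∀ t : ℝ, 0 ≤ t → (t : EReal) < b → (t : EReal) < b' → X t = Y t

lemma IsSolution.apply_zero (hX : IsSolution φ 𝒟 x b X) : X 0 = x := hX.2.1

lemma IsSolution.init_mem (hX : IsSolution φ 𝒟 x b X) : x ∈ 𝒟 :=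
  hX.apply_zero ▸ hX.2.2.1 0 le_rfl hX.1

lemma IsSolution.mem (hX : IsSolution φ 𝒟 x b X) (htb : (t : EReal) < b) (hs : s ∈ Icc 0 t) :
    X s ∈ 𝒟 :=
  hX.2.2.1 s hs.1 ((EReal.coe_le_coe_iff.2 hs.2).trans_lt htb)

lemma IsSolution.hasDerivWithinAt (hX : IsSolution φ 𝒟 x b X) (htb : (t : EReal) < b)
    (hs : s ∈ Icc 0 t) : HasDerivWithinAt X (φ (X s)) (Ici 0) s :=
  hX.2.2.2.1 s hs.1 ((EReal.coe_le_coe_iff.2 hs.2).trans_lt htb)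

lemma IsSolution.flow_eq (hφ : HasUniqueSolutions φ 𝒟) (hX : IsSolution φ 𝒟 x b X)
    (ht : 0 ≤ t) (htb : (t : EReal) < b) : flow φ 𝒟 t x = X t := by
  have hex : ∃ X : ℝ → E, ∃ b : EReal, (t : EReal) < b ∧ IsSolution φ 𝒟 x b X := ⟨X, b, htb, hX⟩
  obtain ⟨b', htb', hY⟩ := Classical.choose_spec hex
  rw [flow, dif_pos hex]
  exact hφ hY hX t ht htb' htb

lemma exists_isSolution_of_lt_lifetime (hφ : HasUniqueSolutions φ 𝒟)
    (ht : (t : EReal) < lifetime φ 𝒟 x) :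
    ∃ (b : EReal) (X : ℝ → E), (t : EReal) < b ∧ IsSolution φ 𝒟 x b X ∧
      ∀ s ∈ Icc 0 t, flow φ 𝒟 s x = X s := by
  obtain ⟨b, ⟨X, hX⟩, htb⟩ := lt_sSup_iff.1 ht
  exact ⟨b, X, htb, hX, fun s hs =>
    hX.flow_eq hφ hs.1 ((EReal.coe_le_coe_iff.2 hs.2).trans_lt htb)⟩

lemma exitTime_le_lifetime : exitTime φ 𝒟 U x ≤ lifetime φ 𝒟 x :=
  sSup_le fun _ ⟨_, h, _, hb, _⟩ => h ▸ hb.le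

lemma flow_mem_of_lt_exitTime (ht : (t : EReal) < exitTime φ 𝒟 U x) (hs : s ∈ Icc 0 t) :
    flow φ 𝒟 s x ∈ U := by
  obtain ⟨_, ⟨b, rfl, -, -, hU⟩, htb⟩ := lt_sSup_iff.1 ht
  exact hU s hs.1 (hs.2.trans_lt (EReal.coe_lt_coe_iff.1 htb))

end Flow

section BlockMatrix

variable {m n : Type*}

lemma toBlocks₂₂_posDef {M : Matrix (m ⊕ n) (m ⊕ n) ℝ} (hM : M.PosDef) : M.toBlocks₂₂.PosDef :=
  hM.submatrix Sum.inr_injective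

lemma isSymm_of_isHermitian {S : Matrix n n ℝ} (hS : S.IsHermitian) : S.IsSymm := by
  simpa only [IsHermitian, IsSymm, conjTranspose_eq_transpose_of_trivial] using hS

variable [Fintype n] [DecidableEq n]

lemma posDef_schurComplement₂₂ [Finite m] {A : Matrix m m ℝ} {B : Matrix m n ℝ}
    {D : Matrix n n ℝ} (h : (fromBlocks A B Bᴴ D).PosDef) : (A - B * D⁻¹ * Bᴴ).PosDef := by
  classical
  cases nonempty_fintype m
  have hD : D.PosDef := by simpa only [toBlocks_fromBlocks₂₂] using toBlocks₂₂_posDef h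
  let _ := hD.isUnit.invertible
  rw [((PosDef.fromBlocks₂₂ A B hD).1 h.posSemidef).posDef_iff_isUnit, ← invOf_eq_nonsing_inv]
  exact isUnit_fromBlocks_iff_of_invertible₂₂.1 h.isUnit

lemma complete_square {R : Type*} [CommRing R] {S : Matrix n n R} (hsymm : S.IsSymm)
    (hunit : IsUnit S) (N K : Matrix n m R) :
    (K + S⁻¹ * N)ᵀ * S * (K + S⁻¹ * N) = Kᵀ * S * K + Kᵀ * N + Nᵀ * K + Nᵀ * S⁻¹ * N := by
  have hdet : IsUnit S.det := (isUnit_iff_isUnit_det S).1 hunit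
  simp only [transpose_add, transpose_mul, transpose_nonsing_inv, hsymm.eq, Matrix.add_mul,
    Matrix.mul_add, Matrix.mul_assoc, nonsing_inv_mul_cancel_left _ _ hdet,
    mul_nonsing_inv_cancel_left _ _ hdet]
  abel

end BlockMatrix

namespace Coeffs

variable {n k : ℕ} (c : Coeffs n k)

/-- The Lyapunov operator of the linear system obtained from the feedback `u = Kx`, that is, with
`A` and `C` replaced by `A + BK` and `C + DK`. -/
def closedLoop (K : Matrix (Fin k) (Fin n) ℝ) :
    Matrix (Fin n) (Fin n) ℝ →ₗ[ℝ] Matrix (Fin n) (Fin n) ℝ :=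
  lyapunov (c.A + c.B * K) (c.C + c.D * K)

/-- The running cost `(1, K)' [[Q, L'], [L, R]] (1, K)` of the feedback `u = Kx`. -/
def cost (K : Matrix (Fin k) (Fin n) ℝ) : Matrix (Fin n) (Fin n) ℝ :=
  c.Q + c.Lᵀ * K + Kᵀ * c.L + Kᵀ * c.R * K

/-- The least running cost over all feedbacks: the Schur complement `Q - L'R⁻¹L` of `R` in the
weight matrix. -/
def minCost : Matrix (Fin n) (Fin n) ℝ :=
  c.Q - c.Lᵀ * c.R⁻¹ * c.L

/-- The feedback gain minimizing `K ↦ closedLoop K P + cost K`. -/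
def gain (P : Matrix (Fin n) (Fin n) ℝ) : Matrix (Fin k) (Fin n) ℝ :=
  -((c.R + c.Dᵀ * P * c.D)⁻¹ * (c.Bᵀ * P + c.Dᵀ * P * c.C + c.L))

variable {c} (hc : c.weight.PosDef)
include hc

lemma posDef_R : c.R.PosDef := by
  simpa only [weight, toBlocks_fromBlocks₂₂] using toBlocks₂₂_posDef hc

lemma posDef_minCost : c.minCost.PosDef := by
  simpa only [conjTranspose_eq_transpose_of_trivial, transpose_transpose, minCost] using
    posDef_schurComplement₂₂ (B := c.Lᵀ)
      (by simpa only [conjTranspose_eq_transpose_of_trivial, transpose_transpose, weight] using hc)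

variable {P : Matrix (Fin n) (Fin n) ℝ}

lemma posDef_R_add (hP : 0 ≤ P) : (c.R + c.Dᵀ * P * c.D).PosDef :=
  posDef_of_le (posDef_R hc) (le_add_of_nonneg_right (nonneg_transpose_mul_mul hP c.D))

lemma minCost_le_cost (K : Matrix (Fin k) (Fin n) ℝ) : c.minCost ≤ c.cost K := by
  have hR := posDef_R hc
  have hsquare : c.cost K - c.minCost = (K + c.R⁻¹ * c.L)ᵀ * c.R * (K + c.R⁻¹ * c.L) := by
    rw [complete_square (isSymm_of_isHermitian hR.1) hR.isUnit, cost, minCost]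
    abel
  rw [← sub_nonneg, hsquare]
  exact nonneg_transpose_mul_mul hR.posSemidef.nonneg _

lemma closedLoop_add_cost_eq (hP : 0 ≤ P) (K : Matrix (Fin k) (Fin n) ℝ) :
    c.closedLoop K P + c.cost K =
      c.phi P + (K - c.gain P)ᵀ * (c.R + c.Dᵀ * P * c.D) * (K - c.gain P) := by
  have hS := posDef_R_add hc hP
  have hPt : Pᵀ = P := isSymm_of_isHermitian (nonneg_iff_posSemidef.1 hP).1
  rw [gain, sub_neg_eq_add, complete_square (isSymm_of_isHermitian hS.1) hS.isUnit]
  simp only [closedLoop, lyapunov_apply, cost, phi, transpose_add, transpose_mul,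
    transpose_transpose, hPt, Matrix.mul_add, Matrix.add_mul, Matrix.mul_assoc]
  abel

lemma phi_le_closedLoop_add_cost (hP : 0 ≤ P) (K : Matrix (Fin k) (Fin n) ℝ) :
    c.phi P ≤ c.closedLoop K P + c.cost K := by
  rw [closedLoop_add_cost_eq hc hP]
  exact le_add_of_nonneg_right
    (nonneg_transpose_mul_mul (posDef_R_add hc hP).posSemidef.nonneg _)

lemma closedLoop_gain_add_cost_gain (hP : 0 ≤ P) :
    c.closedLoop (c.gain P) P + c.cost (c.gain P) = c.phi P := by
  simp only [closedLoop_add_cost_eq hc hP, sub_self, Matrix.mul_zero, add_zero]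

lemma continuousOn_gain : ContinuousOn c.gain (posDefCone n) := by
  intro P hP
  have hdet : (c.R + c.Dᵀ * P * c.D).det ≠ 0 := (posDef_R_add hc hP.posSemidef.nonneg).det_pos.ne'
  have hinv : ContinuousAt
      (fun P : Matrix (Fin n) (Fin n) ℝ => (c.R + c.Dᵀ * P * c.D)⁻¹) P := by
    refine ContinuousAt.comp (f := fun P => c.R + c.Dᵀ * P * c.D)
      (continuousAt_matrix_inv _ ?_) (by fun_prop)
    rw [Ring.inverse_eq_inv']
    exact continuousAt_inv₀ hdet
  have hlin : ContinuousAt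
      (fun P : Matrix (Fin n) (Fin n) ℝ => c.Bᵀ * P + c.Dᵀ * P * c.C + c.L) P := by fun_prop
  refine ContinuousAt.continuousWithinAt (ContinuousAt.neg ?_)
  exact ((continuous_fst.matrix_mul continuous_snd).tendsto _).comp (hinv.prodMk_nhds hlin)

section Solutions

variable {X X₁ X₂ Y Y' : ℝ → Matrix (Fin n) (Fin n) ℝ} {P P₁ P₂ : Matrix (Fin n) (Fin n) ℝ}
  {b b₁ b₂ : EReal} {t : ℝ}

lemma le_of_deriv_le_closedLoop_add_cost (hX : IsSolution c.phi (posDefCone n) P b X)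
    (htb : (t : EReal) < b) (hYherm : ∀ s ∈ Icc 0 t, (Y s).IsHermitian)
    (hY : ∀ s ∈ Icc 0 t, HasDerivWithinAt Y (Y' s) (Icc 0 t) s)
    (hle : ∀ s ∈ Icc 0 t,
      Y' s ≤ c.closedLoop (c.gain (X s)) (Y s) + c.cost (c.gain (X s)))
    (h0 : Y 0 ≤ P) : ∀ s ∈ Icc 0 t, Y s ≤ X s := by
  have hXpos : ∀ s ∈ Icc 0 t, (X s).PosDef := fun s hs => hX.mem htb hs
  have hXderiv : ∀ s ∈ Icc 0 t, HasDerivWithinAt X (c.phi (X s)) (Icc 0 t) s := fun s hs => by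
    open scoped Matrix.Norms.L2Operator in
    exact (hX.hasDerivWithinAt htb hs).mono Icc_subset_Ici_self
  have hXcont : ContinuousOn X (Icc 0 t) := fun s hs => by
    open scoped Matrix.Norms.L2Operator in
    exact (hXderiv s hs).continuousWithinAt
  have hgain : ContinuousOn (fun s => c.gain (X s)) (Icc 0 t) :=
    (continuousOn_gain hc).comp hXcont hXpos
  refine le_of_lyapunov_add_le (F := fun s => c.A + c.B * c.gain (X s))
    (G := fun s => c.C + c.D * c.gain (X s)) (H := fun s => c.cost (c.gain (X s)))
    ?_ ?_ hYherm (fun s hs => (hXpos s hs).1) hY hXderiv hle (fun s hs => ?_)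
    (hX.apply_zero ▸ h0)
  · fun_prop
  · fun_prop
  · exact (closedLoop_gain_add_cost_gain hc (hXpos s hs).posSemidef.nonneg).le

lemma le_of_isSolution_of_le (hX₁ : IsSolution c.phi (posDefCone n) P₁ b₁ X₁)
    (hX₂ : IsSolution c.phi (posDefCone n) P₂ b₂ X₂) (hP : P₁ ≤ P₂) (ht : 0 ≤ t)
    (htb₁ : (t : EReal) < b₁) (htb₂ : (t : EReal) < b₂) : X₁ t ≤ X₂ t := by
  refine le_of_deriv_le_closedLoop_add_cost hc hX₂ htb₂ (fun s hs => (hX₁.mem htb₁ hs).1)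
    (fun s hs => ?_)
    (fun s hs => phi_le_closedLoop_add_cost hc (hX₁.mem htb₁ hs).posSemidef.nonneg _)
    (hX₁.apply_zero ▸ hP) t (right_mem_Icc.2 ht)
  open scoped Matrix.Norms.L2Operator in
  exact (hX₁.hasDerivWithinAt htb₁ hs).mono Icc_subset_Ici_self

lemma hasUniqueSolutions_phi : HasUniqueSolutions c.phi (posDefCone n) :=
  fun _ _ _ _ _ hX hY _ ht htb htb' => le_antisymm
    (le_of_isSolution_of_le hc hX hY le_rfl ht htb htb')
    (le_of_isSolution_of_le hc hY hX le_rfl ht htb' htb)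

lemma smul_phi_add_smul_le (hP : 0 ≤ P) {α μ ν : ℝ} (hα : α • P ≤ c.minCost) (hμ : 0 ≤ μ)
    (hν : 0 ≤ ν) (hμν : μ + ν ≤ 1) (K : Matrix (Fin k) (Fin n) ℝ) :
    μ • c.phi P + ν • α • P ≤ c.closedLoop K (μ • P) + c.cost K := by
  have hcost := minCost_le_cost hc K
  have hcost_nonneg : 0 ≤ c.cost K := (posDef_minCost hc).posSemidef.nonneg.trans hcost
  calc μ • c.phi P + ν • α • P
      ≤ μ • (c.closedLoop K P + c.cost K) + ν • c.cost K := add_le_add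
        (smul_le_smul_of_nonneg_left (phi_le_closedLoop_add_cost hc hP K) hμ)
        (smul_le_smul_of_nonneg_left (hα.trans hcost) hν)
    _ = c.closedLoop K (μ • P) + (μ + ν) • c.cost K := by
        rw [smul_add, map_smul, add_smul, add_assoc]
    _ ≤ c.closedLoop K (μ • P) + c.cost K := by
        simpa only [one_smul, add_le_add_iff_left] using
          smul_le_smul_of_nonneg_right hμν hcost_nonneg

lemma le_exp_smul_of_isSolution (hX₁ : IsSolution c.phi (posDefCone n) P₁ b₁ X₁)
    (hX₂ : IsSolution c.phi (posDefCone n) P₂ b₂ X₂) {d : ℝ} (hd : 0 ≤ d)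
    (hP : P₁ ≤ Real.exp d • P₂) (ht : 0 ≤ t) (htb₁ : (t : EReal) < b₁)
    (htb₂ : (t : EReal) < b₂) {α : ℝ} (hα : ∀ s ∈ Icc 0 t, α • X₁ s ≤ c.minCost) :
    X₁ t ≤ Real.exp (Real.exp (-α * t) * d) • X₂ t := by
  let x : ℝ → ℝ := fun s => Real.exp (-α * s) * d
  let μ : ℝ → ℝ := fun s => Real.exp (-x s)
  have hx : ∀ s, 0 ≤ x s := fun s => by positivity
  have hμ : ∀ s, HasDerivAt μ (x s * μ s * α) s := fun s => by
    convert ((hasDerivAt_const_mul (-α)).exp.mul_const d).fun_neg.exp using 1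
    simp only [μ, x]
    ring
  have hbound : ∀ s, μ s + x s * μ s ≤ 1 := fun s => by
    calc μ s + x s * μ s = (x s + 1) * μ s := by ring
      _ ≤ Real.exp (x s) * μ s :=
        mul_le_mul_of_nonneg_right (Real.add_one_le_exp _) (Real.exp_pos _).le
      _ = 1 := by rw [← Real.exp_add, add_neg_cancel, Real.exp_zero]
  have h0 : μ 0 • X₁ 0 ≤ P₂ := by
    simpa only [hX₁.apply_zero, μ, x, mul_zero, Real.exp_zero, one_mul, Real.exp_neg] using
      (inv_smul_le_iff_of_pos (Real.exp_pos d)).2 hP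
  -- Scaling by `μ` frees the cost `(1 - μ) • minCost`, which pays for the growth of `μ`.
  have hle : μ t • X₁ t ≤ X₂ t := by
    refine le_of_deriv_le_closedLoop_add_cost hc hX₂ htb₂ (Y := fun s => μ s • X₁ s)
      (fun s hs => isHermitian_smul (hX₁.mem htb₁ hs).1 _)
      (Y' := fun s => μ s • c.phi (X₁ s) + (x s * μ s) • α • X₁ s) (fun s hs => ?_)
      (fun s hs => smul_phi_add_smul_le hc (hX₁.mem htb₁ hs).posSemidef.nonneg (hα s hs)
        (Real.exp_pos _).le (mul_nonneg (hx s) (Real.exp_pos _).le) (hbound s) _)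
      h0 t (right_mem_Icc.2 ht)
    rw [smul_smul]
    open scoped Matrix.Norms.L2Operator in
    exact (hμ s).hasDerivWithinAt.smul
      ((hX₁.hasDerivWithinAt htb₁ hs).mono Icc_subset_Ici_self)
  exact (inv_smul_le_iff_of_pos (Real.exp_pos _)).1 (by simpa only [μ, Real.exp_neg] using hle)

lemma le_exp_smul_of_closedLoop_add_cost_le {B : Matrix (Fin n) (Fin n) ℝ} (hB : B.PosDef)
    {K : Matrix (Fin k) (Fin n) ℝ} {κ : ℝ} (hκ : 0 ≤ κ)
    (hK : c.closedLoop K B + c.cost K ≤ κ • B) (hX : IsSolution c.phi (posDefCone n) P b X)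
    (hP : P ≤ B) (ht : 0 ≤ t) (htb : (t : EReal) < b) : X t ≤ Real.exp (κ * t) • B := by
  have hcost : 0 ≤ c.cost K := (posDef_minCost hc).posSemidef.nonneg.trans (minCost_le_cost hc K)
  have hsuper : ∀ s ∈ Icc 0 t, c.closedLoop K (Real.exp (κ * s) • B) + c.cost K ≤
      (Real.exp (κ * s) * κ) • B := fun s hs => by
    have hone : 1 ≤ Real.exp (κ * s) := Real.one_le_exp (mul_nonneg hκ hs.1)
    calc c.closedLoop K (Real.exp (κ * s) • B) + c.cost K
        ≤ Real.exp (κ * s) • c.closedLoop K B + Real.exp (κ * s) • c.cost K := by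
          rw [map_smul]
          exact add_le_add_right (by
            simpa only [one_smul] using smul_le_smul_of_nonneg_right hone hcost) _
      _ ≤ Real.exp (κ * s) • κ • B := by
          rw [← smul_add]
          exact smul_le_smul_of_nonneg_left hK (Real.exp_pos _).le
      _ = (Real.exp (κ * s) * κ) • B := smul_smul _ _ _
  refine le_of_lyapunov_add_le (F := fun _ => c.A + c.B * K) (G := fun _ => c.C + c.D * K)
    (H := fun _ => c.cost K) (Z := fun s => Real.exp (κ * s) • B) continuousOn_const
    continuousOn_const (fun s hs => (hX.mem htb hs).1) (fun s _ => isHermitian_smul hB.1 _)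
    (fun s hs => ?_) (fun s _ => ?_)
    (fun s hs => phi_le_closedLoop_add_cost hc (hX.mem htb hs).posSemidef.nonneg K) hsuper ?_ t
    (right_mem_Icc.2 ht)
  · open scoped Matrix.Norms.L2Operator in
    exact (hX.hasDerivWithinAt htb hs).mono Icc_subset_Ici_self
  · open scoped Matrix.Norms.L2Operator in
    exact (hasDerivAt_const_mul κ).exp.hasDerivWithinAt.smul_const B
  · simpa only [hX.apply_zero, mul_zero, Real.exp_zero, one_smul] using hP

end Solutions

section Contraction

variable {P P₁ P₂ : Matrix (Fin n) (Fin n) ℝ} {S : Set (Matrix (Fin n) (Fin n) ℝ)} {t : ℝ}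

lemma bddAbove_setOf_M (hS : BddAbove S) (T : ℝ) :
    BddAbove {X | ∃ P ∈ S, ∃ t ∈ Icc 0 T,
      (t : EReal) < lifetime c.phi (posDefCone n) P ∧ c.M t P = X} := by
  obtain ⟨B, hBpos, hB⟩ := exists_posDef_forall_le_of_bddAbove hS
  have hcost : 0 ≤ c.cost 0 := (posDef_minCost hc).posSemidef.nonneg.trans (minCost_le_cost hc 0)
  have hherm : (c.closedLoop 0 B + c.cost 0).IsHermitian :=
    (isHermitian_lyapunov _ _ hBpos.1).add (nonneg_iff_posSemidef.1 hcost).1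
  obtain ⟨κ, hκ, hκB⟩ := exists_pos_le_smul hherm hBpos
  refine ⟨Real.exp (κ * T) • B, ?_⟩
  rintro _ ⟨P, hP, t, ht, htb, rfl⟩
  obtain ⟨b, X, htb, hX, hflow⟩ := exists_isSolution_of_lt_lifetime (hasUniqueSolutions_phi hc) htb
  rw [M, hflow t (right_mem_Icc.2 ht.1)]
  refine (le_exp_smul_of_closedLoop_add_cost_le hc hBpos hκ.le hκB hX (hB P hP hX.init_mem) ht.1
    htb).trans (smul_le_smul_of_nonneg_right ?_ hBpos.posSemidef.nonneg)
  exact Real.exp_le_exp.2 (mul_le_mul_of_nonneg_left ht.2 hκ.le)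

lemma posDef_M (ht : 0 ≤ t) (htb : (t : EReal) < lifetime c.phi (posDefCone n) P) :
    (c.M t P).PosDef := by
  obtain ⟨b, X, htb, hX, hflow⟩ := exists_isSolution_of_lt_lifetime (hasUniqueSolutions_phi hc) htb
  rw [M, hflow t (right_mem_Icc.2 ht)]
  exact hX.mem htb (right_mem_Icc.2 ht)

variable [NeZero n]

lemma thompson_M_le {α : ℝ} (ht : 0 ≤ t) (htb₁ : (t : EReal) < lifetime c.phi (posDefCone n) P₁)
    (htb₂ : (t : EReal) < lifetime c.phi (posDefCone n) P₂)
    (hα₁ : ∀ s ∈ Icc 0 t, α • c.M s P₁ ≤ c.minCost)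
    (hα₂ : ∀ s ∈ Icc 0 t, α • c.M s P₂ ≤ c.minCost) :
    thompson (c.M t P₁) (c.M t P₂) ≤ Real.exp (-α * t) * thompson P₁ P₂ := by
  obtain ⟨b₁, X₁, htb₁, hX₁, hflow₁⟩ :=
    exists_isSolution_of_lt_lifetime (hasUniqueSolutions_phi hc) htb₁
  obtain ⟨b₂, X₂, htb₂, hX₂, hflow₂⟩ :=
    exists_isSolution_of_lt_lifetime (hasUniqueSolutions_phi hc) htb₂
  have hP₁ : P₁.PosDef := hX₁.init_mem
  have hP₂ : P₂.PosDef := hX₂.init_mem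
  have htt : t ∈ Icc 0 t := right_mem_Icc.2 ht
  have hd := thompson_nonneg hP₁ hP₂
  rw [M, M, hflow₁ t htt, hflow₂ t htt]
  exact thompson_le (hX₁.mem htb₁ htt) (hX₂.mem htb₂ htt)
    (le_exp_smul_of_isSolution hc hX₁ hX₂ hd (le_exp_thompson_smul hP₁ hP₂) ht htb₁ htb₂
      fun s hs => hflow₁ s hs ▸ hα₁ s hs)
    (le_exp_smul_of_isSolution hc hX₂ hX₁ hd (le_exp_thompson_smul' hP₁ hP₂) ht htb₂ htb₁
      fun s hs => hflow₂ s hs ▸ hα₂ s hs)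

lemma thompson_M_le_of_lt_exit {α : ℝ} (hα : ∀ P ∈ S, P.PosDef → α • P ≤ c.minCost)
    (ht : 0 ≤ t) (hts : (t : EReal) < min (c.exit S P₁) (c.exit S P₂)) :
    thompson (c.M t P₁) (c.M t P₂) ≤ Real.exp (-α * t) * thompson P₁ P₂ := by
  have hrate : ∀ P, (t : EReal) < c.exit S P → ∀ s ∈ Icc 0 t, α • c.M s P ≤ c.minCost := by
    intro P htP s hs
    exact hα _ (flow_mem_of_lt_exitTime htP hs) (posDef_M hc hs.1
      ((EReal.coe_le_coe_iff.2 hs.2).trans_lt (htP.trans_le exitTime_le_lifetime)))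
  obtain ⟨ht₁, ht₂⟩ := lt_min_iff.1 hts
  exact thompson_M_le hc ht (ht₁.trans_le exitTime_le_lifetime)
    (ht₂.trans_le exitTime_le_lifetime) (hrate P₁ ht₁) (hrate P₂ ht₂)

lemma exists_pos_forall_thompson_M_le (hS : BddAbove S) (T : ℝ) :
    ∃ α : ℝ, 0 < α ∧ ∀ P₁ ∈ S, ∀ P₂ ∈ S, ∀ t : ℝ, 0 ≤ t → t ≤ T →
      (t : EReal) < min (c.exit (posDefCone n) P₁) (c.exit (posDefCone n) P₂) →
      thompson (c.M t P₁) (c.M t P₂) ≤ Real.exp (-α * t) * thompson P₁ P₂ := by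
  obtain ⟨α, hα_pos, hα⟩ :=
    exists_pos_forall_smul_le_of_bddAbove (bddAbove_setOf_M hc hS T) (posDef_minCost hc)
  refine ⟨α, hα_pos, fun P₁ hP₁ P₂ hP₂ t ht htT hts => ?_⟩
  have hrate : ∀ P ∈ S, (t : EReal) < lifetime c.phi (posDefCone n) P →
      ∀ s ∈ Icc 0 t, α • c.M s P ≤ c.minCost := by
    intro P hP htP s hs
    have hsP := (EReal.coe_le_coe_iff.2 hs.2).trans_lt htP
    exact hα _ ⟨P, hP, s, ⟨hs.1, hs.2.trans htT⟩, hsP, rfl⟩ (posDef_M hc hs.1 hsP)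
  obtain ⟨ht₁, ht₂⟩ := lt_min_iff.1 hts
  have htb₁ := ht₁.trans_le exitTime_le_lifetime
  have htb₂ := ht₂.trans_le exitTime_le_lifetime
  exact thompson_M_le hc ht htb₁ htb₂ (hrate P₁ hP₁ htb₁) (hrate P₂ hP₂ htb₂)

lemma thompson_M_lt (hP₁ : P₁.PosDef) (hP₂ : P₂.PosDef) (hne : P₁ ≠ P₂) (ht : 0 < t)
    (hts : (t : EReal) < min (c.exit (posDefCone n) P₁) (c.exit (posDefCone n) P₂)) :
    thompson (c.M t P₁) (c.M t P₂) < thompson P₁ P₂ := by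
  have hbdd : BddAbove ({P₁, P₂} : Set (Matrix (Fin n) (Fin n) ℝ)) := by
    refine ⟨P₁ + P₂, ?_⟩
    rintro P (rfl | rfl)
    · exact le_add_of_nonneg_right hP₂.posSemidef.nonneg
    · exact le_add_of_nonneg_left hP₁.posSemidef.nonneg
  obtain ⟨α, hα_pos, hα⟩ := exists_pos_forall_thompson_M_le hc hbdd t
  refine (hα P₁ (Or.inl rfl) P₂ (Or.inr rfl) t ht.le le_rfl hts).trans_lt
    (mul_lt_of_lt_one_left (thompson_pos hP₁ hP₂ hne) (Real.exp_lt_one_iff.2 ?_))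
  exact mul_neg_of_neg_of_pos (neg_neg_of_pos hα_pos) ht

end Contraction

end Coeffs

end GRDE

end

theorem mainTheorem2_general {n k : ℕ} [NeZero n] (c : GRDE.Coeffs n k) (hc : c.weight.PosDef) :
    (∀ (U : Set (Matrix (Fin n) (Fin n) ℝ)) (P₀ : Matrix (Fin n) (Fin n) ℝ),
      P₀.PosDef → (∀ P ∈ U, P ≤ P₀) →
      0 < GRDE.lowerRatio (c.Q - c.L.transpose * c.R⁻¹ * c.L) P₀ ∧
      ∀ P₁ ∈ U, ∀ P₂ ∈ U, ∀ t : ℝ, 0 ≤ t → (t : EReal) < min (c.exit U P₁) (c.exit U P₂) →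
        GRDE.thompson (c.M t P₁) (c.M t P₂) ≤
          Real.exp (-(GRDE.lowerRatio (c.Q - c.L.transpose * c.R⁻¹ * c.L) P₀) * t)
            * GRDE.thompson P₁ P₂) ∧
    (∀ P₁ P₂ : Matrix (Fin n) (Fin n) ℝ, P₁.PosDef → P₂.PosDef → P₁ ≠ P₂ →
      ∀ t : ℝ, 0 < t →
        (t : EReal) < min (c.exit (GRDE.posDefCone n) P₁) (c.exit (GRDE.posDefCone n) P₂) →
        GRDE.thompson (c.M t P₁) (c.M t P₂) < GRDE.thompson P₁ P₂) ∧
    (∀ S : Set (Matrix (Fin n) (Fin n) ℝ), BddAbove S →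
      ∃ α : ℝ, 0 < α ∧ ∀ P₁ ∈ S, ∀ P₂ ∈ S, ∀ t : ℝ, 0 ≤ t →
        (t : EReal) < min (c.exit S P₁) (c.exit S P₂) →
        GRDE.thompson (c.M t P₁) (c.M t P₂) ≤ Real.exp (-α * t) * GRDE.thompson P₁ P₂) ∧
    (∀ S : Set (Matrix (Fin n) (Fin n) ℝ), BddAbove S → ∀ T : ℝ,
      ∃ α : ℝ, 0 < α ∧ ∀ P₁ ∈ S, ∀ P₂ ∈ S, ∀ t : ℝ, 0 ≤ t → t ≤ T →
        (t : EReal) < min (c.exit (GRDE.posDefCone n) P₁) (c.exit (GRDE.posDefCone n) P₂) →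
        GRDE.thompson (c.M t P₁) (c.M t P₂) ≤ Real.exp (-α * t) * GRDE.thompson P₁ P₂) := by
  have hmin := GRDE.Coeffs.posDef_minCost hc
  refine ⟨fun U P₀ hP₀ hU => ?_,
    fun P₁ P₂ hP₁ hP₂ hne t => GRDE.Coeffs.thompson_M_lt hc hP₁ hP₂ hne, fun S hS => ?_,
    fun S hS => GRDE.Coeffs.exists_pos_forall_thompson_M_le hc hS⟩
  · have hα : 0 < GRDE.lowerRatio c.minCost P₀ := GRDE.lowerRatio_pos hmin hP₀
    refine ⟨hα, fun P₁ _ P₂ _ t => GRDE.Coeffs.thompson_M_le_of_lt_exit hc fun P hP _ => ?_⟩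
    exact (smul_le_smul_of_nonneg_left (hU P hP) hα.le).trans
      (GRDE.lowerRatio_smul_le hmin hP₀)
  · obtain ⟨α, hα, hrate⟩ := GRDE.exists_pos_forall_smul_le_of_bddAbove hS hmin
    exact ⟨α, hα, fun P₁ _ P₂ _ t => GRDE.Coeffs.thompson_M_le_of_lt_exit hc hrate⟩

theorem mainTheorem2 {n k : ℕ} (hn : 0 < n) (c : GRDE.Coeffs n k) (hc : c.weight.PosDef) :
    -- explicit rate on scaling-invariant open sets bounded above by `P₀`
    (∀ (U : Set (Matrix (Fin n) (Fin n) ℝ)) (P₀ : Matrix (Fin n) (Fin n) ℝ),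
      GRDE.IsOpenInSym U →
      (∀ r : ℝ, 0 < r → r ≤ 1 → ∀ P ∈ U, r • P ∈ U) →
      P₀.PosDef →
      (∀ P ∈ U, P.PosDef ∧ P ≤ P₀) →
      0 < GRDE.lowerRatio (c.Q - c.L.transpose * c.R⁻¹ * c.L) P₀ ∧
      ∀ P₁ ∈ U, ∀ P₂ ∈ U, ∀ t : ℝ, 0 ≤ t → (t : EReal) < min (c.exit U P₁) (c.exit U P₂) →
        GRDE.thompson (c.M t P₁) (c.M t P₂) ≤
          Real.exp (-(GRDE.lowerRatio (c.Q - c.L.transpose * c.R⁻¹ * c.L) P₀) * t)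
            * GRDE.thompson P₁ P₂) ∧
    -- strict contraction on the cone of positive definite matrices
    (∀ P₁ P₂ : Matrix (Fin n) (Fin n) ℝ, P₁.PosDef → P₂.PosDef → P₁ ≠ P₂ →
      ∀ t : ℝ, 0 < t →
        (t : EReal) < min (c.exit (GRDE.posDefCone n) P₁) (c.exit (GRDE.posDefCone n) P₂) →
        GRDE.thompson (c.M t P₁) (c.M t P₂) < GRDE.thompson P₁ P₂) ∧
    -- uniformity on sets bounded above, as long as the trajectories stay in the set
    (∀ S : Set (Matrix (Fin n) (Fin n) ℝ), S ⊆ GRDE.posDefCone n → BddAbove S →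
      ∃ α : ℝ, 0 < α ∧ ∀ P₁ ∈ S, ∀ P₂ ∈ S, ∀ t : ℝ, 0 ≤ t →
        (t : EReal) < min (c.exit S P₁) (c.exit S P₂) →
        GRDE.thompson (c.M t P₁) (c.M t P₂) ≤ Real.exp (-α * t) * GRDE.thompson P₁ P₂) ∧
    -- uniformity over initial values in a set bounded above, on any bounded time interval
    (∀ S : Set (Matrix (Fin n) (Fin n) ℝ), S ⊆ GRDE.posDefCone n → BddAbove S →
      ∀ T : ℝ, 0 < T →
      ∃ α : ℝ, 0 < α ∧ ∀ P₁ ∈ S, ∀ P₂ ∈ S, ∀ t : ℝ, 0 ≤ t → t ≤ T →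
        (t : EReal) < min (c.exit (GRDE.posDefCone n) P₁) (c.exit (GRDE.posDefCone n) P₂) →
        GRDE.thompson (c.M t P₁) (c.M t P₂) ≤ Real.exp (-α * t) * GRDE.thompson P₁ P₂) := by
  have : NeZero n := ⟨hn.ne'⟩
  obtain ⟨hscaling, hstrict, hexit, htime⟩ := mainTheorem2_general c hc
  exact ⟨fun U P₀ _ _ hP₀ hU => hscaling U P₀ hP₀ fun P hP => (hU P hP).2, hstrict,
    fun S _ => hexit S, fun S _ hS T _ => htime S hS T⟩
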